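/- Let $A$ be a finite-dimensional commutative associative unital algebra over $\mathbb{C}$ with Jacobson radical $\mathfrak{J}$, and let $S\subseteq A$ be a semisimple subalgebra with $A=S\oplus\mathfrak{J}$ as vector spaces (a Wedderburn–Malcev splitting). Let $\mathfrak{g}$ be a finite-dimensional complex Lie algebra whose centre $\mathfrak{z}(\mathfrak{g})$ is contained in $[\mathfrak{g},\mathfrak{g}]$, and let $\mathrm{Der}(\mathfrak{g})=\mathfrak{s}\ltimes\mathfrak{r}$ be a Levi decomposition, that is, $\mathfrak{r}$ is the solvable radical of the Lie algebra $\mathrm{Der}(\mathfrak{g})$ and $\mathfrak{s}$ is a semisimple Lie subalgebra of $\mathrm{Der}(\mathfrak{g})$ that is a vector space complement of $\mathfrak{r}$. Let $\mathfrak{g}_A=\mathfrak{g}\otimes_{\mathbb{C}}A$ be the current Lie algebra, with bracket $[x\otimes a,y\otimes b]=[x,y]\otimes ab$. For linear maps $T\in\mathrm{End}(\mathfrak{g})$ and $f\in\mathrm{End}(A)$ let $T\otimes f\in\mathrm{End}(\mathfrak{g}_A)$ be the map $x\otimes b\mapsto T(x)\otimes f(b)$, and for subspaces $U\subseteq\mathrm{End}(\mathfrak{g})$,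 $V\subseteq\mathrm{End}(A)$ let $U\otimes V\subseteq\mathrm{End}(\mathfrak{g}_A)$ be the span of the maps $T\otimes f$ with $T\in U$, $f\in V$. Here $A$ and its subspaces are regarded as subspaces of $\mathrm{End}(A)$ through the multiplications $b\mapsto ab$; $\mathrm{Hom}_{\mathfrak{g}}(\mathfrak{g},\mathfrak{g})$ is the centroid $\{T\in\mathrm{End}(\mathfrak{g}) : T\circ\mathrm{ad}_x=\mathrm{ad}_x\circ T \text{ for all } x\in\mathfrak{g}\}$; and $\mathrm{Hom}(\mathfrak{g}/[\mathfrak{g},\mathfrak{g}],\mathfrak{z}(\mathfrak{g}))$ is regarded as a subspace of $\mathrm{End}(\mathfrak{g})$ by composing with the projection $\mathfrak{g}\to\mathfrak{g}/[\mathfrak{g},\mathfrak{g}]$ and the inclusion $\mathfrak{z}(\mathfrak{g})\to\mathfrak{g}$. If the Lie algebra $\mathrm{Der}(A)$ of derivations of $A$ is solvable, then the radical $\widetilde{\mathfrak{r}}$ of the Lie algebra $\mathrm{Der}(\mathfrak{g}_A)\subseteq\mathrm{End}(\mathfrak{g}_A)$ is $$\widetilde{\mathfrak{r}}=\mathfrak{s}\otimes\mathfrak{J}+\mathfrak{r}\otimes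 A+\mathrm{Hom}_{\mathfrak{g}}(\mathfrak{g},\mathfrak{g})\otimes\mathrm{Der}(A)+\mathrm{Hom}(\mathfrak{g}/[\mathfrak{g},\mathfrak{g}],\mathfrak{z}(\mathfrak{g}))\otimes\mathrm{End}(A),$$ and $\mathfrak{s}\otimes S$ is a semisimple Lie subalgebra of $\mathrm{Der}(\mathfrak{g}_A)$. -/

import Mathlib

open scoped TensorProduct

namespace CurrentLie

section

variable (L : Type*) [LieRing L] [LieAlgebra ℂ L]

/-- The inclusion of `Der(L)` into `End(L)`, as a linear map. -/
def derToEnd : LieDerivation ℂ L L →ₗ[ℂ] Module.End ℂ L where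
  toFun D := D.toLinearMap
  map_add' _ _ := rfl
  map_smul' _ _ := rfl

/-- The centroid `Hom_L(L, L)`: the endomorphisms `T` with `ad x ∘ T = T ∘ ad x` for all `x`. -/
def centroid : Submodule ℂ (Module.End ℂ L) where
  carrier := {T | ∀ x y : L, ⁅x, T y⁆ = T ⁅x, y⁆}
  zero_mem' _ _ := by simp
  add_mem' hT hU x y := by simp [hT x y, hU x y]
  smul_mem' c T hT x y := by simp [hT x y]

/-- The derived algebra `[L, L]`. -/
abbrev derived : LieIdeal ℂ L := ⁅(⊤ : LieIdeal ℂ L), (⊤ : LieIdeal ℂ L)⁆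

/-- `Hom(L / [L, L], 𝔷(L))` inside `End(L)`: the composites `L → L / [L, L] → 𝔷(L) → L` of a
linear map with the projection and the inclusion. -/
def homAbCenter : Submodule ℂ (Module.End ℂ L) :=
  LinearMap.range
    ((LinearMap.llcomp ℂ L (LieAlgebra.center ℂ L) L (LieAlgebra.center ℂ L).toSubmodule.subtype).comp
      (LinearMap.lcomp ℂ (LieAlgebra.center ℂ L) (derived L).toSubmodule.mkQ))

end

section

variable (A : Type*) [CommRing A] [Algebra ℂ A]

/-- A subspace `V` of `A` viewed inside `End(A)`, through the multiplications `b ↦ a * b`. -/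
def mulEnd (V : Submodule ℂ A) : Submodule ℂ (Module.End ℂ A) :=
  V.map (LinearMap.mul ℂ A)

/-- The derivations of the algebra `A`, as a subspace of `End(A)`. -/
def algDer : Submodule ℂ (Module.End ℂ A) where
  carrier := {f | ∃ D : Derivation ℂ A A, (D : A →ₗ[ℂ] A) = f}
  zero_mem' := ⟨0, rfl⟩
  add_mem' := by
    rintro _ _ ⟨D, rfl⟩ ⟨E, rfl⟩
    exact ⟨D + E, rfl⟩
  smul_mem' := by
    rintro c _ ⟨D, rfl⟩
    exact ⟨c • D, rfl⟩

/-- The Jacobson radical of `A`, as a complex subspace. -/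
def jac : Submodule ℂ A := (Ring.jacobson A).restrictScalars ℂ

end

/-- For subspaces `U ⊆ End(L)` and `V ⊆ End(A)`, the subspace `U ⊗ V` of `End(L ⊗ A)`: the span of
the maps `T ⊗ f` with `T ∈ U` and `f ∈ V`. The underlying space is written `A ⊗[ℂ] L`, which is
Mathlib's current Lie algebra, with bracket `⁅a ⊗ x, b ⊗ y⁆ = (a * b) ⊗ ⁅x, y⁆`. -/
def tensorEnd {L A : Type*} [LieRing L] [LieAlgebra ℂ L] [CommRing A] [Algebra ℂ A]
    (U : Submodule ℂ (Module.End ℂ L)) (V : Submodule ℂ (Module.End ℂ A)) :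
    Submodule ℂ (Module.End ℂ (A ⊗[ℂ] L)) :=
  Submodule.map₂ (TensorProduct.mapBilinear (RingHom.id ℂ) A L A L) V U

end CurrentLie

/-! Write Hom for `homAbCenter g`, C for the centroid and J for the radical of A. The candidate
radical is W = r⊗A + Der(g)⊗J + C⊗Der(A) + Hom⊗End(A); since r⊗J lies in r⊗A, this is the stated
sum. It suffices that W is a solvable ideal of Der(g⊗A), that s⊗S has no radical, and that the two
span Der(g⊗A) (`radical_eq_of_sup_eq_top`).

Spanning rests on `lieDer_current`: Der(g⊗A) = Der(g)⊗A + C⊗Der(A) + Hom⊗End(A). Combined with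
Der(g) = s + r and A = S + J, it leaves only s⊗S outside W.

W is an ideal because every derivation of A has values in J (`derivation_mem_jac`), so commutators
of Der(g)⊗A with C⊗Der(A) stay in Der(g)⊗J + C⊗Der(A).

Solvability is a descent in stages. The derived series of r removes r⊗A; that of Der(A) reduces
Der(A) to the derivations raising the J-adic filtration; nilpotency of J then removes everything but
Hom⊗End(A). This last piece is abelian because the centre lies in [g, g], so that products of two
elements of Hom vanish.

For s⊗S, the characters of A give evaluations s⊗S → s that are jointly injective, as S meets J
trivially. They send abelian ideals to abelian ideals of s, which are zero. -/

namespace CurrentLie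

/-! ### Derivations of A and the radical filtration. -/

section Algebra

variable {A : Type*} [CommRing A]

/-- In an Artinian ring, an element of a maximal ideal is nilpotent up to a factor outside the
ideal. -/
theorem exists_notMem_mul_pow_eq_zero [IsArtinianRing A] {m : Ideal A} [hm : m.IsMaximal] {a : A}
    (ha : a ∈ m) : ∃ n : ℕ, ∃ e ∉ m, e * a ^ n = 0 := by
  -- The ideals generated by the powers of `a` stabilise: `a ^ n = c * a ^ (n + 1)`, so `1 - c * a`
  -- kills `a ^ n`.
  obtain ⟨n, c, hc⟩ := IsArtinian.exists_pow_succ_smul_dvd a (1 : A)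
  refine ⟨n, 1 - c * a, fun h => hm.ne_top ?_, ?_⟩
  · rw [Ideal.eq_top_iff_one]
    simpa using m.add_mem h (m.mul_mem_left c ha)
  · simp only [smul_eq_mul, mul_one, pow_succ] at hc
    linear_combination -hc

variable [Algebra ℂ A]

/-- Differentiating `e * a ^ (j + 1) * D a ^ p = 0` and multiplying by `e * D a` makes the terms
with `D e` and `D (D a)` multiples of the original relation. What survives is `(j + 1) * e ^ 2 * a ^
j * D a ^ (p + 2) = 0`, and `j + 1` is invertible over ℂ. Each power of `a` is thus traded for two
of `D a`. -/
theorem derivation_mem_of_mul_pow_eq_zero {m : Ideal A} [hm : m.IsPrime] (D : Derivation ℂ A A)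
    (a : A) (j : ℕ) : ∀ p : ℕ, (∃ e ∉ m, e * a ^ j * D a ^ p = 0) → D a ∈ m := by
  induction j with
  | zero =>
    rintro p ⟨e, he, h⟩
    rw [pow_zero, mul_one] at h
    have : e * D a ^ p ∈ m := h ▸ m.zero_mem
    exact hm.mem_of_pow_mem p ((hm.mem_or_mem this).resolve_left he)
  | succ j ih =>
    rintro p ⟨e, he, h⟩
    refine ih (p + 2) ⟨e * e, fun h' => (hm.mem_or_mem h').elim he he, ?_⟩
    have h1 := congrArg D h
    simp only [Derivation.leibniz, Derivation.leibniz_pow, map_zero, smul_eq_mul, nsmul_eq_mul,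
      Nat.add_sub_cancel] at h1
    have h2 : ((j + 1 : ℕ) : A) * (e * e * a ^ j * D a ^ (p + 2)) = 0 := by
      -- The derivative of `D a ^ p` involves the truncated exponent `p - 1`, hence the separate
      -- case `p = 0`.
      rcases p with _ | p
      · simp only [pow_zero, mul_one, Nat.cast_zero, zero_mul, mul_zero, zero_add] at h1 h
        linear_combination (e * D a) * h1 - D e * D a * h
      · simp only [Nat.add_sub_cancel] at h1
        linear_combination (e * D a) * h1 - (D e * D a + (p + 1 : ℕ) * e * D (D a)) * h
    have h3 : IsUnit ((j + 1 : ℕ) : A) := by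
      have : ((j + 1 : ℕ) : A) = algebraMap ℂ A ((j + 1 : ℕ) : ℂ) := by simp
      rw [this]
      exact (IsUnit.mk0 _ (by exact_mod_cast j.succ_ne_zero)).map _
    exact (h3.mul_right_eq_zero).1 h2

theorem mem_jac_iff {a : A} : a ∈ jac A ↔ ∀ m : Ideal A, m.IsMaximal → a ∈ m := by
  rw [jac, Submodule.restrictScalars_mem, Ring.jacobson_eq_sInf_isMaximal, Submodule.mem_sInf]
  rfl

variable (A) in
/-- The powers of the Jacobson radical, as complex subspaces. -/
def jacPow (k : ℕ) : Submodule ℂ A := (Ring.jacobson A ^ k).restrictScalars ℂ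

theorem mul_mem_jacPow {j k : ℕ} {a b : A} (ha : a ∈ jacPow A j) (hb : b ∈ jacPow A k) :
    a * b ∈ jacPow A (j + k) := by
  rw [jacPow, Submodule.restrictScalars_mem, pow_add] at *
  exact Ideal.mul_mem_mul ha hb

theorem jacPow_zero : jacPow A 0 = ⊤ := by simp [jacPow]

theorem jacPow_one : jacPow A 1 = jac A := by simp [jacPow, jac]

theorem jacPow_anti {j k : ℕ} (h : j ≤ k) : jacPow A k ≤ jacPow A j := fun _ hx =>
  Ideal.pow_le_pow_right h hx

variable (A) in
/-- The derivations of `A` that raise the radical filtration by `k`. -/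
def algDerFil (k : ℕ) : Submodule ℂ (Module.End ℂ A) where
  carrier := {f | f ∈ algDer A ∧ ∀ j, ∀ a ∈ jacPow A j, f a ∈ jacPow A (j + k)}
  zero_mem' := ⟨zero_mem _, fun _ _ _ => zero_mem _⟩
  add_mem' hf hg := ⟨add_mem hf.1 hg.1, fun j a ha => add_mem (hf.2 j a ha) (hg.2 j a ha)⟩
  smul_mem' c _ hf := ⟨Submodule.smul_mem _ c hf.1,
    fun j a ha => Submodule.smul_mem _ c (hf.2 j a ha)⟩

theorem algDerFil_le (k : ℕ) : algDerFil A k ≤ algDer A := fun _ h => h.1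

theorem algDerFil_eq_bot {k : ℕ} (h : jacPow A k = ⊥) : algDerFil A k = ⊥ := by
  rw [eq_bot_iff]
  rintro f ⟨-, hf⟩
  rw [Submodule.mem_bot]
  ext a
  have := hf 0 a (by simp [jacPow_zero])
  rwa [zero_add, h, Submodule.mem_bot] at this

theorem mul_mem_algDer {a : A} {f : Module.End ℂ A} (hf : f ∈ algDer A) :
    LinearMap.mul ℂ A a * f ∈ algDer A := by
  obtain ⟨D, rfl⟩ := hf
  exact ⟨a • D, rfl⟩

theorem comm_mem_algDer {f h : Module.End ℂ A} (hf : f ∈ algDer A) (hh : h ∈ algDer A) :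
    f * h - h * f ∈ algDer A := by
  obtain ⟨D, rfl⟩ := hf
  obtain ⟨E, rfl⟩ := hh
  exact ⟨⁅D, E⁆, LinearMap.ext fun a => Derivation.commutator_apply a⟩

theorem mul_mem_algDerFil {j k : ℕ} {a : A} {f : Module.End ℂ A} (ha : a ∈ jacPow A j)
    (hf : f ∈ algDerFil A k) : LinearMap.mul ℂ A a * f ∈ algDerFil A (j + k) := by
  refine ⟨mul_mem_algDer hf.1, fun i b hb => ?_⟩
  have := mul_mem_jacPow ha (hf.2 i b hb)
  rwa [show j + (i + k) = i + (j + k) by omega] at this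

theorem comm_mem_algDerFil {j k : ℕ} {f h : Module.End ℂ A} (hf : f ∈ algDerFil A j)
    (hh : h ∈ algDerFil A k) : f * h - h * f ∈ algDerFil A (j + k) := by
  refine ⟨comm_mem_algDer hf.1 hh.1, fun i b hb => sub_mem ?_ ?_⟩
  · have := hf.2 _ _ (hh.2 i b hb)
    rwa [show i + k + j = i + (j + k) by omega] at this
  · have := hh.2 _ _ (hf.2 i b hb)
    rwa [show i + j + k = i + (j + k) by omega] at this

/-- A derivation does not commute with multiplications: `f ∘ a = a ∘ f + f(a)`. -/
theorem algDer_mul {a : A} {f : Module.End ℂ A} (hf : f ∈ algDer A) :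
    f * LinearMap.mul ℂ A a = LinearMap.mul ℂ A a * f + LinearMap.mul ℂ A (f a) := by
  obtain ⟨D, rfl⟩ := hf
  ext b
  simp [mul_comm b]

variable [FiniteDimensional ℂ A]

theorem exists_sub_algebraMap_mem (m : Ideal A) [hm : m.IsMaximal] (a : A) :
    ∃ c : ℂ, a - algebraMap ℂ A c ∈ m := by
  let _ : Field (A ⧸ m) := Ideal.Quotient.field m
  obtain ⟨c, hc⟩ := (IsAlgClosed.algebraMap_bijective_of_isIntegral (k := ℂ) (K := A ⧸ m)).2
    (Ideal.Quotient.mk m a)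
  refine ⟨c, ?_⟩
  rw [← Ideal.Quotient.eq, ← hc]
  rfl

theorem derivation_mem_jac (D : Derivation ℂ A A) (a : A) : D a ∈ jac A := by
  rw [mem_jac_iff]
  intro m hm
  have : IsArtinianRing A := IsArtinianRing.of_finite ℂ A
  -- The residue field is ℂ, and subtracting a constant from `a` does not change `D a`.
  obtain ⟨c, hc⟩ := exists_sub_algebraMap_mem m a
  obtain ⟨n, e, he, h⟩ := exists_notMem_mul_pow_eq_zero hc
  have := derivation_mem_of_mul_pow_eq_zero D _ n 0 ⟨e, he, by simpa using h⟩
  simpa using this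

theorem exists_algHom_ne_zero {a : A} (ha : a ∉ jac A) : ∃ χ : A →ₐ[ℂ] ℂ, χ a ≠ 0 := by
  rw [mem_jac_iff] at ha
  push Not at ha
  obtain ⟨m, hm, ham⟩ := ha
  let _ : Field (A ⧸ m) := Ideal.Quotient.field m
  let e : ℂ ≃ₐ[ℂ] (A ⧸ m) := AlgEquiv.ofBijective (Algebra.ofId ℂ (A ⧸ m))
    (IsAlgClosed.algebraMap_bijective_of_isIntegral (k := ℂ) (K := A ⧸ m))
  refine ⟨(e.symm : (A ⧸ m) →ₐ[ℂ] ℂ).comp (Ideal.Quotient.mkₐ ℂ m), fun h => ham ?_⟩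
  have h' : e.symm (Ideal.Quotient.mk m a) = 0 := h
  rw [EmbeddingLike.map_eq_zero_iff] at h'
  exact Ideal.Quotient.eq_zero_iff_mem.1 h'

theorem exists_jacPow_eq_bot : ∃ n, jacPow A n = ⊥ := by
  have : IsArtinianRing A := IsArtinianRing.of_finite ℂ A
  obtain ⟨n, hn⟩ := IsSemiprimaryRing.isNilpotent (R := A)
  exact ⟨n, by rw [jacPow, hn]; rfl⟩

theorem derivation_mem_jacPow (D : Derivation ℂ A A) (j : ℕ) :
    ∀ a ∈ jacPow A j, D a ∈ jacPow A j := by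
  induction j with
  | zero => simp [jacPow_zero]
  | succ j ih =>
    intro a ha
    rw [jacPow, Submodule.restrictScalars_mem, pow_succ] at ha
    refine Submodule.mul_induction_on ha (fun x hx y hy => ?_) (fun x y hx hy => ?_)
    · rw [D.leibniz]
      refine add_mem (mul_mem_jacPow hx ?_) ?_
      · rw [jacPow_one]; exact derivation_mem_jac D y
      · rw [add_comm]
        exact mul_mem_jacPow (by rw [jacPow_one]; exact hy) (ih x hx)
    · rw [map_add]; exact add_mem hx hy

theorem algDerFil_zero : algDerFil A 0 = algDer A := by
  refine le_antisymm (algDerFil_le 0) ?_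
  rintro _ ⟨D, rfl⟩
  exact ⟨⟨D, rfl⟩, derivation_mem_jacPow D⟩

end Algebra

/-! ### Products of derivations, centroid elements and maps L/[L, L] → centre. -/

section Derivations

variable {L : Type*} [LieRing L] [LieAlgebra ℂ L]

variable (L) in
/-- The Lie derivations of `L`, as a subspace of `End(L)`. -/
def lieDer : Submodule ℂ (Module.End ℂ L) := LinearMap.range (derToEnd L)

theorem mem_lieDer {d : Module.End ℂ L} :
    d ∈ lieDer L ↔ ∀ x y, d ⁅x, y⁆ = ⁅d x, y⁆ + ⁅x, d y⁆ := by
  constructor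
  · rintro ⟨D, rfl⟩ x y
    exact (D.apply_lie_eq_add x y).trans (add_comm _ _)
  · intro h
    refine ⟨⟨d, fun x y => ?_⟩, rfl⟩
    rw [h, ← lie_skew (d x) y]
    abel

theorem derToEnd_apply (D : LieDerivation ℂ L L) (x : L) : derToEnd L D x = D x := rfl

theorem derToEnd_injective : Function.Injective (derToEnd L) := fun _ _ h =>
  LieDerivation.ext fun x => LinearMap.congr_fun h x

theorem derToEnd_lie (D E : LieDerivation ℂ L L) :
    derToEnd L ⁅D, E⁆ = derToEnd L D * derToEnd L E - derToEnd L E * derToEnd L D := by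
  ext x
  simp [derToEnd_apply]

theorem comm_mem_lieDer {d e : Module.End ℂ L} (hd : d ∈ lieDer L) (he : e ∈ lieDer L) :
    d * e - e * d ∈ lieDer L := by
  obtain ⟨D, rfl⟩ := hd
  obtain ⟨E, rfl⟩ := he
  exact ⟨⁅D, E⁆, derToEnd_lie D E⟩

theorem mem_center {z : L} : z ∈ LieAlgebra.center ℂ L ↔ ∀ x : L, ⁅x, z⁆ = 0 :=
  LieModule.mem_maxTrivSubmodule ℂ L L z

theorem lie_mem_derived (x y : L) : ⁅x, y⁆ ∈ derived L :=
  LieSubmodule.lie_mem_lie (LieSubmodule.mem_top x) (LieSubmodule.mem_top y)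

theorem derived_le {P : Submodule ℂ L} (h : ∀ x y : L, ⁅x, y⁆ ∈ P) :
    (derived L).toSubmodule ≤ P := by
  rw [derived, LieSubmodule.lieIdeal_oper_eq_linear_span, Submodule.span_le]
  rintro _ ⟨x, y, rfl⟩
  exact h _ _

theorem mem_homAbCenter_iff {h : Module.End ℂ L} :
    h ∈ homAbCenter L ↔ (∀ y z : L, h ⁅y, z⁆ = 0) ∧ ∀ x y : L, ⁅x, h y⁆ = 0 := by
  constructor
  · rintro ⟨f, rfl⟩
    refine ⟨fun y z => ?_, fun x y => mem_center.1 (f _).2 x⟩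
    have h1 : (derived L).toSubmodule.mkQ ⁅y, z⁆ = 0 :=
      (Submodule.Quotient.mk_eq_zero _).2 (lie_mem_derived y z)
    simp only [LinearMap.comp_apply, LinearMap.llcomp_apply, LinearMap.lcomp_apply, h1, map_zero]
  · rintro ⟨h1, h2⟩
    have h3 : (derived L).toSubmodule ≤ LinearMap.ker
        (h.codRestrict (LieAlgebra.center ℂ L).toSubmodule
          fun y => mem_center.2 fun x => h2 x y) :=
      derived_le fun x y => by
        rw [LinearMap.mem_ker]
        exact Subtype.ext (h1 x y)
    exact ⟨(derived L).toSubmodule.liftQ _ h3, rfl⟩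

theorem mem_centroid {T : Module.End ℂ L} :
    T ∈ centroid L ↔ ∀ x y : L, T ⁅x, y⁆ = ⁅x, T y⁆ :=
  ⟨fun h x y => (h x y).symm, fun h x y => (h x y).symm⟩

theorem centroid_lie_left {T : Module.End ℂ L} (hT : T ∈ centroid L) (x y : L) :
    T ⁅x, y⁆ = ⁅T x, y⁆ := by
  rw [← lie_skew, map_neg, mem_centroid.1 hT, lie_skew]

theorem mem_homAbCenter_of_centroid {T : Module.End ℂ L} (hT : T ∈ centroid L)
    (h : ∀ x y : L, T ⁅x, y⁆ = 0) : T ∈ homAbCenter L :=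
  mem_homAbCenter_iff.2 ⟨h, fun x y => by rw [← mem_centroid.1 hT, h]⟩

theorem homAbCenter_le_centroid : homAbCenter L ≤ centroid L := fun h hh => by
  obtain ⟨h1, h2⟩ := mem_homAbCenter_iff.1 hh
  exact mem_centroid.2 fun x y => by rw [h1, h2]

theorem centroid_mul_mem {T U : Module.End ℂ L} (hT : T ∈ centroid L) (hU : U ∈ centroid L) :
    T * U ∈ centroid L :=
  mem_centroid.2 fun x y => by
    rw [Module.End.mul_apply, mem_centroid.1 hU, mem_centroid.1 hT, Module.End.mul_apply]

theorem centroid_mul_lieDer {T d : Module.End ℂ L} (hT : T ∈ centroid L) (hd : d ∈ lieDer L) :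
    T * d ∈ lieDer L :=
  mem_lieDer.2 fun x y => by
    simp only [Module.End.mul_apply]
    rw [mem_lieDer.1 hd, map_add, centroid_lie_left hT, mem_centroid.1 hT]

theorem lieDer_comm_centroid {T d : Module.End ℂ L} (hd : d ∈ lieDer L) (hT : T ∈ centroid L) :
    d * T - T * d ∈ centroid L :=
  mem_centroid.2 fun x y => by
    simp only [LinearMap.sub_apply, Module.End.mul_apply]
    rw [mem_lieDer.1 hd, map_add, mem_centroid.1 hT, mem_lieDer.1 hd, mem_centroid.1 hT,
      mem_centroid.1 hT, lie_sub]
    abel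

/-- Both products send `⁅x, y⁆` to `⁅T x, U y⁆`, so the commutator vanishes on brackets. -/
theorem centroid_comm_centroid {T U : Module.End ℂ L} (hT : T ∈ centroid L)
    (hU : U ∈ centroid L) : T * U - U * T ∈ homAbCenter L := by
  refine mem_homAbCenter_of_centroid
    (sub_mem (centroid_mul_mem hT hU) (centroid_mul_mem hU hT)) fun x y => ?_
  simp only [LinearMap.sub_apply, Module.End.mul_apply]
  rw [mem_centroid.1 hU, centroid_lie_left hT, centroid_lie_left hT, mem_centroid.1 hU, sub_self]

theorem centroid_mul_homAbCenter {T h : Module.End ℂ L} (hT : T ∈ centroid L)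
    (hh : h ∈ homAbCenter L) : T * h ∈ homAbCenter L := by
  obtain ⟨h1, h2⟩ := mem_homAbCenter_iff.1 hh
  refine mem_homAbCenter_iff.2 ⟨fun x y => ?_, fun x y => ?_⟩
  · rw [Module.End.mul_apply, h1, map_zero]
  · rw [Module.End.mul_apply, ← mem_centroid.1 hT, h2, map_zero]

theorem homAbCenter_mul_centroid {T h : Module.End ℂ L} (hT : T ∈ centroid L)
    (hh : h ∈ homAbCenter L) : h * T ∈ homAbCenter L := by
  obtain ⟨h1, h2⟩ := mem_homAbCenter_iff.1 hh
  refine mem_homAbCenter_iff.2 ⟨fun x y => ?_, fun x y => ?_⟩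
  · rw [Module.End.mul_apply, mem_centroid.1 hT, h1]
  · rw [Module.End.mul_apply, h2]

theorem lieDer_mul_homAbCenter {d h : Module.End ℂ L} (hd : d ∈ lieDer L)
    (hh : h ∈ homAbCenter L) : d * h ∈ homAbCenter L := by
  obtain ⟨h1, h2⟩ := mem_homAbCenter_iff.1 hh
  refine mem_homAbCenter_iff.2 ⟨fun x y => ?_, fun x y => ?_⟩
  · rw [Module.End.mul_apply, h1, map_zero]
  · have := mem_lieDer.1 hd x (h y)
    rw [h2, h2, map_zero, zero_add] at this
    exact this.symm

theorem homAbCenter_mul_lieDer {d h : Module.End ℂ L} (hd : d ∈ lieDer L)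
    (hh : h ∈ homAbCenter L) : h * d ∈ homAbCenter L := by
  obtain ⟨h1, h2⟩ := mem_homAbCenter_iff.1 hh
  refine mem_homAbCenter_iff.2 ⟨fun x y => ?_, fun x y => ?_⟩
  · rw [Module.End.mul_apply, mem_lieDer.1 hd, map_add, h1, h1, add_zero]
  · rw [Module.End.mul_apply, h2]

/-- The image of `k` is central, hence inside [L, L], which `h` kills. -/
theorem homAbCenter_mul_homAbCenter (hz : LieAlgebra.center ℂ L ≤ derived L)
    {h k : Module.End ℂ L} (hh : h ∈ homAbCenter L) (hk : k ∈ homAbCenter L) : h * k = 0 := by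
  have h1 : (derived L).toSubmodule ≤ LinearMap.ker h :=
    derived_le fun x y => (mem_homAbCenter_iff.1 hh).1 x y
  ext x
  exact h1 (hz (mem_center.2 fun y => (mem_homAbCenter_iff.1 hk).2 y x))

end Derivations

/-! ### Commutator inclusions between subspaces of endomorphisms. -/

section CommLE

variable {V : Type*} [AddCommGroup V] [Module ℂ V]

/-- The commutators of endomorphisms in `P` with endomorphisms in `Q` lie in `R`. -/
def CommLE (P Q R : Submodule ℂ (Module.End ℂ V)) : Prop :=
  ∀ x ∈ P, ∀ y ∈ Q, x * y - y * x ∈ R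

variable {P P' Q R R' : Submodule ℂ (Module.End ℂ V)}

theorem CommLE.symm (h : CommLE P Q R) : CommLE Q P R := fun x hx y hy => by
  rw [← neg_sub]
  exact neg_mem (h y hy x hx)

theorem CommLE.mono (h : CommLE P Q R) (hR : R ≤ R') : CommLE P Q R' := fun x hx y hy =>
  hR (h x hx y hy)

theorem CommLE.mono_left (h : CommLE P Q R) (hP : P' ≤ P) : CommLE P' Q R := fun x hx y hy =>
  h x (hP hx) y hy

theorem CommLE.sup_left (h : CommLE P Q R) (h' : CommLE P' Q R) : CommLE (P ⊔ P') Q R := by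
  intro x hx y hy
  obtain ⟨p, hp, p', hp', rfl⟩ := Submodule.mem_sup.1 hx
  rw [add_mul, mul_add, add_sub_add_comm]
  exact add_mem (h p hp y hy) (h' p' hp' y hy)

theorem CommLE.sup_right (h : CommLE Q P R) (h' : CommLE Q P' R) : CommLE Q (P ⊔ P') R :=
  (h.symm.sup_left h'.symm).symm

theorem CommLE.span {s t : Set (Module.End ℂ V)}
    (h : ∀ x ∈ s, ∀ y ∈ t, x * y - y * x ∈ R) :
    CommLE (Submodule.span ℂ s) (Submodule.span ℂ t) R := by
  intro x hx y hy
  induction hx using Submodule.span_induction with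
  | zero => simp
  | add a b _ _ ha hb =>
    rw [add_mul, mul_add, add_sub_add_comm]
    exact add_mem ha hb
  | smul c a _ ha =>
    rw [smul_mul_assoc, mul_smul_comm, ← smul_sub]
    exact Submodule.smul_mem _ c ha
  | mem x hx =>
    induction hy using Submodule.span_induction with
    | zero => simp
    | add a b _ _ ha hb =>
      rw [add_mul, mul_add, add_sub_add_comm]
      exact add_mem ha hb
    | smul c a _ ha =>
      rw [smul_mul_assoc, mul_smul_comm, ← smul_sub]
      exact Submodule.smul_mem _ c ha
    | mem y hy => exact h x hx y hy

end CommLE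

/-! ### Commutators, contractions and coefficients in End(L⊗A). -/

section TensorEnd

variable {L A : Type*} [LieRing L] [LieAlgebra ℂ L] [CommRing A] [Algebra ℂ A]

theorem map_sub_right (f : Module.End ℂ A) (T U : Module.End ℂ L) :
    TensorProduct.map f (T - U) = TensorProduct.map f T - TensorProduct.map f U :=
  map_sub (TensorProduct.mapBilinear (RingHom.id ℂ) A L A L f) T U

theorem map_sub_left (f h : Module.End ℂ A) (T : Module.End ℂ L) :
    TensorProduct.map (f - h) T = TensorProduct.map f T - TensorProduct.map h T :=
  LinearMap.map_sub₂ (TensorProduct.mapBilinear (RingHom.id ℂ) A L A L) f h T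

theorem tensorEnd_eq_span (U : Submodule ℂ (Module.End ℂ L)) (V : Submodule ℂ (Module.End ℂ A)) :
    tensorEnd U V = Submodule.span ℂ
      {Φ | ∃ f ∈ V, ∃ T ∈ U, TensorProduct.map f T = Φ} := by
  rw [tensorEnd, Submodule.map₂_eq_span_image2]
  rfl

theorem map_mem_tensorEnd {U : Submodule ℂ (Module.End ℂ L)} {V : Submodule ℂ (Module.End ℂ A)}
    {f : Module.End ℂ A} {T : Module.End ℂ L} (hT : T ∈ U) (hf : f ∈ V) :
    TensorProduct.map f T ∈ tensorEnd U V :=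
  Submodule.apply_mem_map₂ _ hf hT

theorem tensorEnd_le {U : Submodule ℂ (Module.End ℂ L)} {V : Submodule ℂ (Module.End ℂ A)}
    {P : Submodule ℂ (Module.End ℂ (A ⊗[ℂ] L))}
    (h : ∀ f ∈ V, ∀ T ∈ U, TensorProduct.map f T ∈ P) : tensorEnd U V ≤ P :=
  Submodule.map₂_le.2 h

theorem tensorEnd_mono {U U' : Submodule ℂ (Module.End ℂ L)} {V V' : Submodule ℂ (Module.End ℂ A)}
    (hU : U ≤ U') (hV : V ≤ V') : tensorEnd U V ≤ tensorEnd U' V' :=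
  Submodule.map₂_le_map₂ hV hU

theorem commLE_tensorEnd {U U' : Submodule ℂ (Module.End ℂ L)}
    {V V' : Submodule ℂ (Module.End ℂ A)} {P : Submodule ℂ (Module.End ℂ (A ⊗[ℂ] L))}
    (h : ∀ f ∈ V, ∀ T ∈ U, ∀ f' ∈ V', ∀ T' ∈ U',
      TensorProduct.map (f * f') (T * T') - TensorProduct.map (f' * f) (T' * T) ∈ P) :
    CommLE (tensorEnd U V) (tensorEnd U' V') P := by
  rw [tensorEnd_eq_span, tensorEnd_eq_span]
  apply CommLE.span
  rintro _ ⟨f, hf, T, hT, rfl⟩ _ ⟨f', hf', T', hT', rfl⟩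
  rw [← TensorProduct.map_mul, ← TensorProduct.map_mul]
  exact h f hf T hT f' hf' T' hT'

theorem mul_mem_mulEnd {V : Submodule ℂ A} {a : A} (ha : a ∈ V) :
    LinearMap.mul ℂ A a ∈ mulEnd A V := Submodule.mem_map_of_mem ha

theorem mulEnd_mono {V V' : Submodule ℂ A} (h : V ≤ V') : mulEnd A V ≤ mulEnd A V' :=
  Submodule.map_mono h

theorem commLE_current_current {U U' U'' : Submodule ℂ (Module.End ℂ L)} {I I' I'' : Submodule ℂ A}
    (hU : CommLE U U' U'') (hI : ∀ a ∈ I, ∀ b ∈ I', a * b ∈ I'') :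
    CommLE (tensorEnd U (mulEnd A I)) (tensorEnd U' (mulEnd A I')) (tensorEnd U'' (mulEnd A I'')) := by
  apply commLE_tensorEnd
  rintro _ ⟨a, ha, rfl⟩ d hd _ ⟨b, hb, rfl⟩ e he
  have h1 : LinearMap.mul ℂ A a * LinearMap.mul ℂ A b = LinearMap.mul ℂ A (a * b) := by
    ext; simp [mul_assoc]
  have h2 : LinearMap.mul ℂ A b * LinearMap.mul ℂ A a = LinearMap.mul ℂ A (a * b) := by
    ext; simp [mul_left_comm, mul_assoc]
  rw [h1, h2, ← map_sub_right]
  exact map_mem_tensorEnd (hU d hd e he) (mul_mem_mulEnd (hI a ha b hb))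

/-- The identity behind this is [d⊗a, T⊗f] = [d, T]⊗af − Td⊗f(a), where [d, T] is again in the
centroid and Td again a derivation. -/
theorem commLE_current_centroid {U : Submodule ℂ (Module.End ℂ L)} (hU : U ≤ lieDer L)
    {I I' : Submodule ℂ A} {V V' : Submodule ℂ (Module.End ℂ A)} (hV : V ≤ algDer A)
    (h1 : ∀ a ∈ I, ∀ f ∈ V, LinearMap.mul ℂ A a * f ∈ V') (h2 : ∀ a ∈ I, ∀ f ∈ V, f a ∈ I') :
    CommLE (tensorEnd U (mulEnd A I)) (tensorEnd (centroid L) V)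
      (tensorEnd (lieDer L) (mulEnd A I') ⊔ tensorEnd (centroid L) V') := by
  apply commLE_tensorEnd
  rintro _ ⟨a, ha, rfl⟩ d hd f hf T hT
  rw [algDer_mul (hV hf), TensorProduct.map_add_left, ← sub_sub, ← map_sub_right,
    sub_eq_add_neg, add_comm]
  exact Submodule.add_mem_sup
    (neg_mem (map_mem_tensorEnd (centroid_mul_lieDer hT (hU hd)) (mul_mem_mulEnd (h2 a ha f hf))))
    (map_mem_tensorEnd (lieDer_comm_centroid (hU hd) hT) (h1 a ha f hf))

/-- Here [T⊗f, T'⊗f'] = TT'⊗[f, f'] + [T, T']⊗f'f, and [T, T'] falls in `homAbCenter L`. -/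
theorem commLE_centroid_centroid {V V' V'' : Submodule ℂ (Module.End ℂ A)} (hV : CommLE V V' V'') :
    CommLE (tensorEnd (centroid L) V) (tensorEnd (centroid L) V')
      (tensorEnd (centroid L) V'' ⊔ tensorEnd (homAbCenter L) ⊤) := by
  apply commLE_tensorEnd
  intro f hf T hT f' hf' T' hT'
  have : TensorProduct.map (f * f') (T * T') - TensorProduct.map (f' * f) (T' * T) =
      TensorProduct.map (f * f' - f' * f) (T * T') +
        TensorProduct.map (f' * f) (T * T' - T' * T) := by
    rw [map_sub_left, map_sub_right]
    abel
  rw [this]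
  exact Submodule.add_mem_sup
    (map_mem_tensorEnd (centroid_mul_mem hT hT') (hV f hf f' hf'))
    (map_mem_tensorEnd (centroid_comm_centroid hT hT') trivial)

theorem commLE_current_homAbCenter {U : Submodule ℂ (Module.End ℂ L)} (hU : U ≤ lieDer L)
    (V : Submodule ℂ (Module.End ℂ A)) :
    CommLE (tensorEnd U V) (tensorEnd (homAbCenter L) (⊤ : Submodule ℂ (Module.End ℂ A)))
      (tensorEnd (homAbCenter L) ⊤) :=
  commLE_tensorEnd fun _ _ _ hT _ _ _ hT' => sub_mem
    (map_mem_tensorEnd (lieDer_mul_homAbCenter (hU hT) hT') trivial)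
    (map_mem_tensorEnd (homAbCenter_mul_lieDer (hU hT) hT') trivial)

theorem commLE_centroid_homAbCenter (V : Submodule ℂ (Module.End ℂ A)) :
    CommLE (tensorEnd (centroid L) V)
      (tensorEnd (homAbCenter L) (⊤ : Submodule ℂ (Module.End ℂ A)))
      (tensorEnd (homAbCenter L) ⊤) :=
  commLE_tensorEnd fun _ _ _ hT _ _ _ hT' => sub_mem
    (map_mem_tensorEnd (centroid_mul_homAbCenter hT hT') trivial)
    (map_mem_tensorEnd (homAbCenter_mul_centroid hT hT') trivial)

theorem commLE_homAbCenter_homAbCenter (hz : LieAlgebra.center ℂ L ≤ derived L) :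
    CommLE (tensorEnd (homAbCenter L) (⊤ : Submodule ℂ (Module.End ℂ A)))
      (tensorEnd (homAbCenter L) (⊤ : Submodule ℂ (Module.End ℂ A))) ⊥ :=
  commLE_tensorEnd fun _ _ _ hT _ _ _ hT' => by
    rw [homAbCenter_mul_homAbCenter hz hT hT', homAbCenter_mul_homAbCenter hz hT' hT]
    simp

theorem mem_lieDer_of_tmul {Φ : Module.End ℂ (A ⊗[ℂ] L)}
    (h : ∀ (a b : A) (x y : L), Φ ((a * b) ⊗ₜ ⁅x, y⁆) =
      ⁅Φ (a ⊗ₜ x), b ⊗ₜ[ℂ] y⁆ + ⁅a ⊗ₜ[ℂ] x, Φ (b ⊗ₜ y)⁆) : Φ ∈ lieDer (A ⊗[ℂ] L) := by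
  refine mem_lieDer.2 fun u v => ?_
  induction u with
  | zero => simp
  | add u u' hu hu' => simp only [add_lie, map_add, hu, hu']; abel
  | tmul a x =>
    induction v with
    | zero => simp
    | add v v' hv hv' => simp only [lie_add, map_add, hv, hv']; abel
    | tmul b y => exact h a b x y

theorem current_le_lieDer : tensorEnd (lieDer L) (mulEnd A ⊤) ≤ lieDer (A ⊗[ℂ] L) := by
  refine tensorEnd_le ?_
  rintro _ ⟨c, -, rfl⟩ d hd
  refine mem_lieDer_of_tmul fun a b x y => ?_
  simp [mem_lieDer.1 hd, TensorProduct.tmul_add, mul_assoc, mul_left_comm]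

theorem centroid_algDer_le_lieDer :
    tensorEnd (centroid L) (algDer A) ≤ lieDer (A ⊗[ℂ] L) := by
  refine tensorEnd_le ?_
  rintro _ ⟨D, rfl⟩ T hT
  refine mem_lieDer_of_tmul fun a b x y => ?_
  simp [← mem_centroid.1 hT, ← centroid_lie_left hT, TensorProduct.add_tmul, mul_comm b, add_comm]

theorem homAbCenter_top_le_lieDer :
    tensorEnd (homAbCenter L) (⊤ : Submodule ℂ (Module.End ℂ A)) ≤ lieDer (A ⊗[ℂ] L) := by
  refine tensorEnd_le ?_
  rintro f - h hh
  obtain ⟨h1, h2⟩ := mem_homAbCenter_iff.1 hh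
  have h3 : ∀ x y : L, ⁅h x, y⁆ = 0 := fun x y => by rw [← lie_skew, h2, neg_zero]
  refine mem_lieDer_of_tmul fun a b x y => ?_
  simp [h1, h2, h3]

/-- Contraction of the first tensor factor against a linear form. -/
noncomputable def contract (φ : A →ₗ[ℂ] ℂ) : A ⊗[ℂ] L →ₗ[ℂ] L :=
  (TensorProduct.lid ℂ L).toLinearMap ∘ₗ LinearMap.rTensor L φ

@[simp]
theorem contract_tmul (φ : A →ₗ[ℂ] ℂ) (a : A) (x : L) : contract φ (a ⊗ₜ[ℂ] x) = φ a • x := by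
  simp [contract]

theorem contract_lie_one (φ : A →ₗ[ℂ] ℂ) (z : A ⊗[ℂ] L) (y : L) :
    contract φ ⁅z, (1 : A) ⊗ₜ[ℂ] y⁆ = ⁅contract φ z, y⁆ := by
  induction z with
  | zero => simp
  | add u v hu hv => simp [hu, hv]
  | tmul a x => simp

theorem contract_one_lie (φ : A →ₗ[ℂ] ℂ) (x : L) (z : A ⊗[ℂ] L) :
    contract φ ⁅(1 : A) ⊗ₜ[ℂ] x, z⁆ = ⁅x, contract φ z⁆ := by
  induction z with
  | zero => simp
  | add u v hu hv => simp [hu, hv]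
  | tmul a x => simp

theorem sum_tmul_contract {ι : Type*} [Fintype ι] (b : Module.Basis ι ℂ A) (z : A ⊗[ℂ] L) :
    ∑ i, b i ⊗ₜ[ℂ] contract (b.coord i) z = z := by
  induction z with
  | zero => simp
  | add u v hu hv => simp only [map_add, TensorProduct.tmul_add, Finset.sum_add_distrib, hu, hv]
  | tmul a x =>
    simp only [contract_tmul, ← TensorProduct.smul_tmul, ← TensorProduct.sum_tmul,
      Module.Basis.coord_apply, b.sum_repr]

/-- The component of an endomorphism of `A ⊗ L` at `a : A` and a linear form on `A`. -/
noncomputable def slice (Φ : Module.End ℂ (A ⊗[ℂ] L)) (a : A) (φ : A →ₗ[ℂ] ℂ) : Module.End ℂ L :=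
  contract φ ∘ₗ Φ ∘ₗ TensorProduct.mk ℂ A L a

@[simp]
theorem slice_apply (Φ : Module.End ℂ (A ⊗[ℂ] L)) (a : A) (φ : A →ₗ[ℂ] ℂ) (x : L) :
    slice Φ a φ x = contract φ (Φ (a ⊗ₜ x)) := rfl

theorem mem_tensorEnd_top_of_slice [FiniteDimensional ℂ A] {U : Submodule ℂ (Module.End ℂ L)}
    {Φ : Module.End ℂ (A ⊗[ℂ] L)} (h : ∀ a φ, slice Φ a φ ∈ U) : Φ ∈ tensorEnd U ⊤ := by
  let b := Module.finBasis ℂ A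
  -- Expansion in the matrix units of `b`, with the slices as coefficients.
  have : Φ = ∑ j, ∑ i, TensorProduct.map ((b.coord j).smulRight (b i))
      (slice Φ (b j) (b.coord i)) := by
    ext a x
    conv_lhs => rw [← b.sum_repr a]
    simp only [TensorProduct.AlgebraTensorModule.curry_apply, LinearMap.restrictScalars_self,
      TensorProduct.curry_apply, map_sum, LinearMap.sum_apply,
      TensorProduct.map_tmul, LinearMap.smulRight_apply, slice_apply]
    refine Finset.sum_congr rfl fun j _ => ?_
    simp only [← TensorProduct.smul_tmul', map_smul, ← Finset.smul_sum, Module.Basis.coord_apply]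
    rw [sum_tmul_contract]
  rw [this]
  exact sum_mem fun j _ => sum_mem fun i _ => map_mem_tensorEnd (h _ _) trivial

theorem exists_sum_map_of_mem_tensorEnd {ι : Type*} [Fintype ι]
    {U : Submodule ℂ (Module.End ℂ L)} (u : Module.Basis ι ℂ U)
    {V : Submodule ℂ (Module.End ℂ A)} {Φ : Module.End ℂ (A ⊗[ℂ] L)} (h : Φ ∈ tensorEnd U V) :
    ∃ f : ι → Module.End ℂ A, (∀ i, f i ∈ V) ∧ Φ = ∑ i, TensorProduct.map (f i) (u i).1 := by
  rw [tensorEnd_eq_span] at h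
  induction h using Submodule.span_induction with
  | zero => exact ⟨0, fun _ => zero_mem _, by simp⟩
  | add Φ Ψ _ _ hΦ hΨ =>
    obtain ⟨f, hf, rfl⟩ := hΦ
    obtain ⟨f', hf', rfl⟩ := hΨ
    exact ⟨f + f', fun i => add_mem (hf i) (hf' i), by
      simp [TensorProduct.map_add_left, Finset.sum_add_distrib]⟩
  | smul c Φ _ hΦ =>
    obtain ⟨f, hf, rfl⟩ := hΦ
    exact ⟨c • f, fun i => V.smul_mem c (hf i), by
      simp [TensorProduct.map_smul_left, Finset.smul_sum]⟩
  | mem Φ hΦ =>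
    obtain ⟨f, hf, T, hT, rfl⟩ := hΦ
    refine ⟨fun i => u.repr ⟨T, hT⟩ i • f, fun i => V.smul_mem _ hf, ?_⟩
    have := congrArg Subtype.val (u.sum_repr ⟨T, hT⟩)
    simp only [AddSubmonoidClass.coe_finsetSum, SetLike.val_smul] at this
    conv_lhs => rw [← this]
    simp only [TensorProduct.map_smul_left, ← TensorProduct.map_smul_right]
    exact map_sum (TensorProduct.mapBilinear (RingHom.id ℂ) A L A L f) _ _

end TensorEnd

/-! ### The derivations of the current Lie algebra. -/

section Structure

variable {L A : Type*} [LieRing L] [LieAlgebra ℂ L] [CommRing A] [Algebra ℂ A]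

theorem slice_one_mem_lieDer {Φ : Module.End ℂ (A ⊗[ℂ] L)} (hΦ : Φ ∈ lieDer (A ⊗[ℂ] L))
    (φ : A →ₗ[ℂ] ℂ) : slice Φ 1 φ ∈ lieDer L := by
  refine mem_lieDer.2 fun x y => ?_
  have h : (1 : A) ⊗ₜ[ℂ] ⁅x, y⁆ = ⁅(1 : A) ⊗ₜ[ℂ] x, (1 : A) ⊗ₜ[ℂ] y⁆ := by simp
  simp only [slice_apply]
  rw [h, mem_lieDer.1 hΦ, map_add, contract_lie_one, contract_one_lie]

/-- Since `Φ` kills `1 ⊗ L`, it commutes with bracketing by `1 ⊗ x`; contraction preserves this. -/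
theorem slice_mem_centroid {Φ : Module.End ℂ (A ⊗[ℂ] L)} (hΦ : Φ ∈ lieDer (A ⊗[ℂ] L))
    (h1 : ∀ x : L, Φ ((1 : A) ⊗ₜ x) = 0) (a : A) (φ : A →ₗ[ℂ] ℂ) : slice Φ a φ ∈ centroid L := by
  refine mem_centroid.2 fun x y => ?_
  have h : a ⊗ₜ[ℂ] ⁅x, y⁆ = ⁅(1 : A) ⊗ₜ[ℂ] x, a ⊗ₜ[ℂ] y⁆ := by simp
  simp only [slice_apply]
  rw [h, mem_lieDer.1 hΦ, h1, zero_lie, zero_add, contract_one_lie]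

theorem mem_algDer_of_leibniz {f : Module.End ℂ A}
    (h : ∀ a b, f (a * b) = a * f b + b * f a) : f ∈ algDer A :=
  ⟨Derivation.mk' f h, rfl⟩

variable [FiniteDimensional ℂ A] [FiniteDimensional ℂ L]

/-- Expand `Φ` along a basis of `C`. Each linear form turns the Leibniz defects of the coefficients
into a combination of basis vectors that kills brackets. It lies in `C` and in `homAbCenter L`, so
it is zero, and independence makes every defect vanish. -/
theorem mem_of_disjoint_homAbCenter {C : Submodule ℂ (Module.End ℂ L)} (hC : C ≤ centroid L)
    (hd : Disjoint C (homAbCenter L)) {Φ : Module.End ℂ (A ⊗[ℂ] L)}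
    (hΦ : Φ ∈ tensorEnd C ⊤) (hΦ' : Φ ∈ lieDer (A ⊗[ℂ] L)) :
    Φ ∈ tensorEnd (centroid L) (algDer A) := by
  let u := Module.finBasis ℂ C
  obtain ⟨f, -, rfl⟩ := exists_sum_map_of_mem_tensorEnd u hΦ
  refine sum_mem fun i _ => map_mem_tensorEnd (hC (u i).2) (mem_algDer_of_leibniz fun a b => ?_)
  rw [← sub_eq_zero, ← Module.forall_dual_apply_eq_zero_iff ℂ]
  intro φ
  let c : Fin (Module.finrank ℂ C) → ℂ := fun i => φ (f i (a * b) - (a * f i b + b * f i a))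
  have hT : ((∑ i, c i • u i : C) : Module.End ℂ L) ∈ homAbCenter L := by
    refine mem_homAbCenter_of_centroid (hC (Subtype.prop _)) fun x y => ?_
    have h := congrArg (contract φ) (mem_lieDer.1 hΦ' (a ⊗ₜ x) (b ⊗ₜ y))
    simp only [LieAlgebra.ExtendScalars.bracket_tmul, LinearMap.sum_apply, TensorProduct.map_tmul,
      sum_lie, lie_sum, map_sum, map_add, contract_tmul,
      ← centroid_lie_left (hC (u _).2), ← mem_centroid.1 (hC (u _).2)] at h
    simp only [AddSubmonoidClass.coe_finsetSum, SetLike.val_smul, LinearMap.sum_apply,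
      LinearMap.smul_apply]
    simp only [c, map_sub, map_add, sub_smul, add_smul, Finset.sum_sub_distrib,
      Finset.sum_add_distrib, h, mul_comm b]
    abel
  have h0 : ∑ i, c i • u i = 0 :=
    Subtype.ext (Submodule.disjoint_def.1 hd _ (Subtype.prop _) hT)
  exact Fintype.linearIndependent_iff.1 u.linearIndependent c h0 i

/-- Subtracting the part `Φ₀` determined by `Φ` on `1 ⊗ L` leaves a derivation with coefficients in
the centroid. Elements of `homAbCenter L` tensored with any endomorphism of A are derivations, so
they can be split off; a complement in the centroid then carries honest derivations of A. -/
theorem lieDer_current :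
    lieDer (A ⊗[ℂ] L) ≤ tensorEnd (lieDer L) (mulEnd A ⊤) ⊔ tensorEnd (centroid L) (algDer A) ⊔
      tensorEnd (homAbCenter L) ⊤ := by
  intro Φ hΦ
  let b := Module.finBasis ℂ A
  let Φ₀ : Module.End ℂ (A ⊗[ℂ] L) :=
    ∑ i, TensorProduct.map (LinearMap.mul ℂ A (b i)) (slice Φ 1 (b.coord i))
  have h0 : Φ₀ ∈ tensorEnd (lieDer L) (mulEnd A ⊤) := sum_mem fun i _ =>
    map_mem_tensorEnd (slice_one_mem_lieDer hΦ _) (mul_mem_mulEnd trivial)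
  have h1 : ∀ x : L, (Φ - Φ₀) ((1 : A) ⊗ₜ x) = 0 := fun x => by
    simp [Φ₀, sum_tmul_contract]
  have h2 : Φ - Φ₀ ∈ lieDer (A ⊗[ℂ] L) := sub_mem hΦ (current_le_lieDer h0)
  have h3 : Φ - Φ₀ ∈ tensorEnd (centroid L) ⊤ :=
    mem_tensorEnd_top_of_slice fun a φ => slice_mem_centroid h2 h1 a φ
  obtain ⟨Q, hQ⟩ := Submodule.exists_isCompl (homAbCenter L)
  have h4 : centroid L = homAbCenter L ⊔ Q ⊓ centroid L := by
    rw [← sup_inf_assoc_of_le _ homAbCenter_le_centroid, hQ.sup_eq_top, top_inf_eq]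
  rw [h4, tensorEnd, Submodule.map₂_sup_right] at h3
  obtain ⟨Φ₁, h5, Φ₂, h6, h7⟩ := Submodule.mem_sup.1 h3
  have h8 : Φ₂ ∈ lieDer (A ⊗[ℂ] L) := by
    rw [← eq_sub_iff_add_eq'] at h7
    rw [h7]
    exact sub_mem h2 (homAbCenter_top_le_lieDer h5)
  have h9 := mem_of_disjoint_homAbCenter inf_le_right (hQ.disjoint.symm.mono_left inf_le_left) h6 h8
  rw [← sub_add_cancel Φ Φ₀, ← h7, add_assoc, add_comm Φ₂]
  rw [add_comm]
  exact Submodule.add_mem_sup (Submodule.add_mem_sup h0 h9) h5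

end Structure

/-! ### Solvability by descent along subspaces. -/

section Solvable

variable {M : Type*} [LieRing M] [LieAlgebra ℂ M]

/-- Every ideal of the derivation algebra of `M` that is contained in `P` is solvable. -/
def SolvableBelow (P : Submodule ℂ (Module.End ℂ M)) : Prop :=
  ∀ I : LieIdeal ℂ (LieDerivation ℂ M M), I.toSubmodule.map (derToEnd M) ≤ P →
    ∃ k, LieAlgebra.derivedSeriesOfIdeal ℂ (LieDerivation ℂ M M) k I = ⊥

theorem map_lie_le {I J : LieIdeal ℂ (LieDerivation ℂ M M)}
    {P Q R : Submodule ℂ (Module.End ℂ M)} (h : CommLE P Q R)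
    (hI : I.toSubmodule.map (derToEnd M) ≤ P) (hJ : J.toSubmodule.map (derToEnd M) ≤ Q) :
    (⁅I, J⁆ : LieIdeal ℂ _).toSubmodule.map (derToEnd M) ≤ R := by
  rw [Submodule.map_le_iff_le_comap, LieSubmodule.lieIdeal_oper_eq_linear_span',
    Submodule.span_le]
  rintro _ ⟨D, hD, E, hE, rfl⟩
  rw [SetLike.mem_coe, Submodule.mem_comap, derToEnd_lie]
  exact h _ (hI (Submodule.mem_map_of_mem hD)) _ (hJ (Submodule.mem_map_of_mem hE))

/-- If `I` lies in `P`, then `⁅I, I⁆` lies in `Q`. The subspaces themselves need not be ideals, so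
only commutator inclusions have to be checked along a chain. -/
theorem SolvableBelow.of_commLE {P Q : Submodule ℂ (Module.End ℂ M)} (hQ : SolvableBelow Q)
    (h : CommLE P P Q) : SolvableBelow P := by
  intro I hI
  obtain ⟨k, hk⟩ := hQ ⁅I, I⁆ (map_lie_le h hI hI)
  refine ⟨k + 1, ?_⟩
  rwa [LieAlgebra.derivedSeriesOfIdeal_add, LieAlgebra.derivedSeriesOfIdeal_succ,
    LieAlgebra.derivedSeriesOfIdeal_zero]

theorem SolvableBelow.bot : SolvableBelow (⊥ : Submodule ℂ (Module.End ℂ M)) := by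
  intro I hI
  refine ⟨0, ?_⟩
  rw [LieAlgebra.derivedSeriesOfIdeal_zero, LieSubmodule.eq_bot_iff]
  intro D hD
  exact derToEnd_injective ((hI (Submodule.mem_map_of_mem hD)).trans (map_zero _).symm)

theorem SolvableBelow.of_chain {P : ℕ → Submodule ℂ (Module.End ℂ M)} {n : ℕ}
    (hn : SolvableBelow (P n)) (h : ∀ k, CommLE (P k) (P k) (P (k + 1))) :
    SolvableBelow (P 0) := by
  induction n generalizing P with
  | zero => exact hn
  | succ n ih =>
    exact (ih (P := fun k => P (k + 1)) hn fun k => h (k + 1)).of_commLE (h 0)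

end Solvable

/-! ### The candidate radical: ideal property and solvability. -/

section Radical

variable {L A : Type*} [LieRing L] [LieAlgebra ℂ L] [CommRing A] [Algebra ℂ A]

variable (L) in
/-- The subspace `Der(L) ⊗ I + Hom_L(L, L) ⊗ V + Hom(L / [L, L], 𝔷(L)) ⊗ End(A)` of
`End(L ⊗ A)`. -/
def derBlock (I : Submodule ℂ A) (V : Submodule ℂ (Module.End ℂ A)) :
    Submodule ℂ (Module.End ℂ (A ⊗[ℂ] L)) :=
  tensorEnd (lieDer L) (mulEnd A I) ⊔ tensorEnd (centroid L) V ⊔ tensorEnd (homAbCenter L) ⊤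

theorem derBlock_top_le_lieDer : derBlock L ⊤ (algDer A) ≤ lieDer (A ⊗[ℂ] L) :=
  sup_le (sup_le current_le_lieDer centroid_algDer_le_lieDer) homAbCenter_top_le_lieDer

theorem derBlock_mono {I I' : Submodule ℂ A} {V V' : Submodule ℂ (Module.End ℂ A)} (hI : I ≤ I')
    (hV : V ≤ V') : derBlock L I V ≤ derBlock L I' V' :=
  sup_le_sup_right (sup_le_sup (tensorEnd_mono le_rfl (mulEnd_mono hI)) (tensorEnd_mono le_rfl hV)) _

theorem current_le_derBlock (I : Submodule ℂ A) (V : Submodule ℂ (Module.End ℂ A)) :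
    tensorEnd (lieDer L) (mulEnd A I) ≤ derBlock L I V := le_sup_left.trans le_sup_left

theorem centroid_le_derBlock (I : Submodule ℂ A) (V : Submodule ℂ (Module.End ℂ A)) :
    tensorEnd (centroid L) V ≤ derBlock L I V := le_sup_right.trans le_sup_left

theorem homAbCenter_le_derBlock (I : Submodule ℂ A) (V : Submodule ℂ (Module.End ℂ A)) :
    tensorEnd (homAbCenter L) ⊤ ≤ derBlock L I V := le_sup_right

theorem commLE_derBlock_homAbCenter (hz : LieAlgebra.center ℂ L ≤ derived L)
    (I : Submodule ℂ A) (V : Submodule ℂ (Module.End ℂ A)) :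
    CommLE (derBlock L I V) (tensorEnd (homAbCenter L) ⊤) (tensorEnd (homAbCenter L) ⊤) :=
  ((commLE_current_homAbCenter le_rfl _).sup_left (commLE_centroid_homAbCenter _)).sup_left
    ((commLE_homAbCenter_homAbCenter hz).mono bot_le)

theorem commLE_derBlock (hz : LieAlgebra.center ℂ L ≤ derived L) {I I' J : Submodule ℂ A}
    {V V' W : Submodule ℂ (Module.End ℂ A)} (hV : V ≤ algDer A) (hV' : V' ≤ algDer A)
    (hII : ∀ a ∈ I, ∀ b ∈ I', a * b ∈ J)
    (hIV : ∀ a ∈ I, ∀ f ∈ V', LinearMap.mul ℂ A a * f ∈ W ∧ f a ∈ J)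
    (hVI : ∀ a ∈ I', ∀ f ∈ V, LinearMap.mul ℂ A a * f ∈ W ∧ f a ∈ J)
    (hVV : CommLE V V' W) :
    CommLE (derBlock L I V) (derBlock L I' V') (derBlock L J W) := by
  refine CommLE.sup_right (CommLE.sup_right ?_ ?_)
    ((commLE_derBlock_homAbCenter hz _ _).mono (homAbCenter_le_derBlock _ _))
  · refine CommLE.sup_left (CommLE.sup_left ?_ ?_) ?_
    · refine (commLE_current_current ?_ hII).mono (current_le_derBlock _ _)
      exact fun x hx y hy => comm_mem_lieDer hx hy
    · exact ((commLE_current_centroid le_rfl hV (fun a ha f hf => (hVI a ha f hf).1)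
        fun a ha f hf => (hVI a ha f hf).2).mono le_sup_left).symm
    · exact ((commLE_current_homAbCenter le_rfl _).mono (homAbCenter_le_derBlock _ _)).symm
  · refine CommLE.sup_left (CommLE.sup_left ?_ ?_) ?_
    · exact (commLE_current_centroid le_rfl hV' (fun a ha f hf => (hIV a ha f hf).1)
        fun a ha f hf => (hIV a ha f hf).2).mono le_sup_left
    · exact (commLE_centroid_centroid hVV).mono
        (sup_le (centroid_le_derBlock _ _) (homAbCenter_le_derBlock _ _))
    · exact ((commLE_centroid_homAbCenter _).mono (homAbCenter_le_derBlock _ _)).symm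

variable (A) in
/-- The inclusion of the derivations of `A` into `End(A)`, as a linear map. -/
def derivationToEnd : Derivation ℂ A A →ₗ[ℂ] Module.End ℂ A where
  toFun D := D
  map_add' _ _ := rfl
  map_smul' _ _ := rfl

variable (A) in
/-- The derived series of the Lie algebra of derivations of `A`, inside `End(A)`. -/
def algDerSeries (k : ℕ) : Submodule ℂ (Module.End ℂ A) :=
  (LieAlgebra.derivedSeries ℂ (Derivation ℂ A A) k).toSubmodule.map (derivationToEnd A)

theorem algDerSeries_le (k : ℕ) : algDerSeries A k ≤ algDer A := by
  rintro _ ⟨D, -, rfl⟩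
  exact ⟨D, rfl⟩

theorem algDerSeries_zero : algDerSeries A 0 = algDer A := by
  refine le_antisymm (algDerSeries_le 0) ?_
  rintro _ ⟨D, rfl⟩
  exact ⟨D, LieSubmodule.mem_top D, rfl⟩

theorem commLE_algDerSeries (k : ℕ) :
    CommLE (algDerSeries A k) (algDerSeries A k) (algDerSeries A (k + 1)) := by
  rintro _ ⟨D, hD, rfl⟩ _ ⟨E, hE, rfl⟩
  refine ⟨⁅D, E⁆, ?_, LinearMap.ext fun a => Derivation.commutator_apply a⟩
  rw [LieAlgebra.derivedSeries_def, LieAlgebra.derivedSeriesOfIdeal_succ]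
  exact LieSubmodule.lie_mem_lie hD hE

theorem exists_algDerSeries_eq_bot [LieAlgebra.IsSolvable (Derivation ℂ A A)] :
    ∃ k, algDerSeries A k = ⊥ := by
  obtain ⟨k, hk⟩ := (LieAlgebra.isSolvable_iff ℂ (Derivation ℂ A A)).1 inferInstance
  exact ⟨k, by rw [algDerSeries, hk]; exact Submodule.map_bot _⟩

variable [FiniteDimensional ℂ A]

theorem algDer_apply_mem_jac {f : Module.End ℂ A} (hf : f ∈ algDer A) (a : A) : f a ∈ jac A := by
  obtain ⟨D, rfl⟩ := hf
  exact derivation_mem_jac D a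

theorem solvableBelow_derBlock_fil (hz : LieAlgebra.center ℂ L ≤ derived L) :
    SolvableBelow (derBlock L (jacPow A 1) (algDerFil A 1)) := by
  obtain ⟨n, hn⟩ := exists_jacPow_eq_bot (A := A)
  have hn' : jacPow A (n + 1) = ⊥ := le_bot_iff.1 (hn ▸ jacPow_anti n.le_succ)
  refine SolvableBelow.of_chain (n := n)
    (P := fun k => derBlock L (jacPow A (k + 1)) (algDerFil A (k + 1))) ?_ fun k => ?_
  -- At the end of the chain only Hom⊗End(A) is left, which is abelian.
  · refine SolvableBelow.of_commLE (SolvableBelow.of_commLE .bot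
      (commLE_homAbCenter_homAbCenter (A := A) hz)) ?_
    have : derBlock L (jacPow A (n + 1)) (algDerFil A (n + 1)) ≤ tensorEnd (homAbCenter L) ⊤ := by
      rw [derBlock, hn', algDerFil_eq_bot hn', mulEnd, Submodule.map_bot, tensorEnd, tensorEnd,
        Submodule.map₂_bot_left, Submodule.map₂_bot_left, bot_sup_eq, bot_sup_eq]
    exact fun x hx y hy => commLE_derBlock_homAbCenter hz _ _ x hx y (this hy)
  · have h : ∀ f ∈ algDerFil A (k + 1), ∀ a ∈ jacPow A (k + 1),
        LinearMap.mul ℂ A a * f ∈ algDerFil A (k + 1 + (k + 1)) ∧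
          f a ∈ jacPow A (k + 1 + (k + 1)) := fun f hf a ha =>
      ⟨mul_mem_algDerFil ha hf, hf.2 _ a ha⟩
    have := commLE_derBlock (L := L) hz (algDerFil_le (A := A) (k + 1))
      (algDerFil_le (A := A) (k + 1))
      (I := jacPow A (k + 1)) (I' := jacPow A (k + 1))
      (fun a ha b hb => mul_mem_jacPow ha hb) (fun a ha f hf => h f hf a ha)
      (fun a ha f hf => h f hf a ha) fun f hf e he => comm_mem_algDerFil hf he
    -- Commutators land in filtration degree `2 * (k + 1)`, at least the required `k + 2`. Starting
    -- the chain in degree 1 is what makes the degree grow.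
    refine this.mono (derBlock_mono (jacPow_anti (by omega)) fun f hf => ?_)
    exact ⟨hf.1, fun j a ha => jacPow_anti (by omega) (hf.2 j a ha)⟩

/-- The derived series of Der(A) is followed modulo `algDerFil A 1`. That summand absorbs the
products J·Der(A) coming from commutators of Der(L)⊗J with the centroid part. -/
theorem solvableBelow_derBlock_jac (hz : LieAlgebra.center ℂ L ≤ derived L)
    [LieAlgebra.IsSolvable (Derivation ℂ A A)] :
    SolvableBelow (derBlock L (jac A) (algDer A)) := by
  obtain ⟨n, hn⟩ := exists_algDerSeries_eq_bot (A := A)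
  have h0 : algDer A = algDerSeries A 0 ⊔ algDerFil A 1 := by
    rw [algDerSeries_zero, sup_eq_left.2 (algDerFil_le 1)]
  rw [h0]
  refine SolvableBelow.of_chain (n := n)
    (P := fun k => derBlock L (jac A) (algDerSeries A k ⊔ algDerFil A 1)) ?_ fun k => ?_
  · simp only [hn, bot_sup_eq, ← jacPow_one]
    exact solvableBelow_derBlock_fil hz
  · have hle : algDerSeries A k ⊔ algDerFil A 1 ≤ algDer A :=
      sup_le (algDerSeries_le k) (algDerFil_le 1)
    have h : ∀ a ∈ jac A, ∀ f ∈ algDerSeries A k ⊔ algDerFil A 1,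
        LinearMap.mul ℂ A a * f ∈ algDerSeries A (k + 1) ⊔ algDerFil A 1 ∧ f a ∈ jac A := by
      intro a ha f hf
      have hf' : f ∈ algDer A := hle hf
      refine ⟨?_, algDer_apply_mem_jac hf' a⟩
      rw [← jacPow_one] at ha
      rw [← algDerFil_zero] at hf'
      have h1 := mul_mem_algDerFil ha hf'
      rw [add_zero] at h1
      exact Submodule.mem_sup_right h1
    have hfil : CommLE (algDer A) (algDerFil A 1) (algDerSeries A (k + 1) ⊔ algDerFil A 1) := by
      intro f hf e he
      rw [← algDerFil_zero] at hf
      have := comm_mem_algDerFil hf he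
      exact Submodule.mem_sup_right (by simpa using this)
    refine commLE_derBlock hz hle hle (fun a ha b _ => Ideal.mul_mem_right b _ ha) h h ?_
    exact (((commLE_algDerSeries k).mono le_sup_left).sup_left
      (hfil.mono_left (algDerSeries_le k)).symm).sup_right (hfil.mono_left hle)

theorem commLE_derBlock_top_jac (hz : LieAlgebra.center ℂ L ≤ derived L) :
    CommLE (derBlock L ⊤ (algDer A)) (derBlock L (jac A) (algDer A))
      (derBlock L (jac A) (algDer A)) :=
  commLE_derBlock hz le_rfl le_rfl (fun a _ _ hb => Ideal.mul_mem_left _ a hb)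
    (fun a _ _ hf => ⟨mul_mem_algDer hf, algDer_apply_mem_jac hf a⟩)
    (fun a _ _ hf => ⟨mul_mem_algDer hf, algDer_apply_mem_jac hf a⟩)
    fun _ hf _ he => comm_mem_algDer hf he

variable (A) in
/-- The subspace `U ⊗ A + Der(L) ⊗ J + Hom_L(L, L) ⊗ Der(A) + Hom(L / [L, L], 𝔷(L)) ⊗ End(A)` of
`End(L ⊗ A)`, where `J` is the Jacobson radical of `A`. -/
def radBlock (U : Submodule ℂ (Module.End ℂ L)) : Submodule ℂ (Module.End ℂ (A ⊗[ℂ] L)) :=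
  tensorEnd U (mulEnd A ⊤) ⊔ derBlock L (jac A) (algDer A)

theorem commLE_radBlock (hz : LieAlgebra.center ℂ L ≤ derived L)
    {U U' : Submodule ℂ (Module.End ℂ L)} (hU : U ≤ lieDer L) (h : CommLE U U U') :
    CommLE (radBlock A U) (radBlock A U) (radBlock A U') := by
  have h1 : CommLE (tensorEnd U (mulEnd A ⊤)) (derBlock L (jac A) (algDer A)) (radBlock A U') :=
    ((commLE_derBlock_top_jac hz).mono_left
      ((tensorEnd_mono hU le_rfl).trans (current_le_derBlock _ _))).mono le_sup_right
  have h2 : CommLE (derBlock L (jac A) (algDer A)) (derBlock L (jac A) (algDer A))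
      (radBlock A U') :=
    ((commLE_derBlock_top_jac hz).mono_left (derBlock_mono le_top le_rfl)).mono le_sup_right
  exact (((commLE_current_current h fun _ _ _ _ => Submodule.mem_top).mono le_sup_left).sup_left
    h1.symm).sup_right (h1.sup_left h2)

theorem commLE_derBlock_radBlock (hz : LieAlgebra.center ℂ L ≤ derived L)
    {U : Submodule ℂ (Module.End ℂ L)} (hU : U ≤ lieDer L) (h : CommLE (lieDer L) U U) :
    CommLE (derBlock L ⊤ (algDer A)) (radBlock A U) (radBlock A U) := by
  refine CommLE.sup_right (CommLE.sup_left (CommLE.sup_left ?_ ?_) ?_)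
    ((commLE_derBlock_top_jac hz).mono le_sup_right)
  · exact (commLE_current_current h fun _ _ _ _ => Submodule.mem_top).mono le_sup_left
  · refine ((commLE_current_centroid hU le_rfl (fun _ _ _ hf => mul_mem_algDer hf)
      fun a _ _ hf => algDer_apply_mem_jac hf a).mono ?_).symm
    exact (le_sup_left (b := tensorEnd (homAbCenter L) ⊤)).trans le_sup_right
  · exact ((commLE_current_homAbCenter hU _).mono
      ((homAbCenter_le_derBlock _ _).trans le_sup_right)).symm

theorem solvableBelow_radBlock (hz : LieAlgebra.center ℂ L ≤ derived L)
    [LieAlgebra.IsSolvable (Derivation ℂ A A)] (r : LieIdeal ℂ (LieDerivation ℂ L L))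
    [LieAlgebra.IsSolvable r] : SolvableBelow (radBlock A (r.toSubmodule.map (derToEnd L))) := by
  obtain ⟨n, hn⟩ := (LieAlgebra.isSolvable_iff ℂ r).1 inferInstance
  rw [LieIdeal.derivedSeries_eq_bot_iff] at hn
  refine SolvableBelow.of_chain (n := n) (P := fun k => radBlock A
    ((LieAlgebra.derivedSeriesOfIdeal ℂ (LieDerivation ℂ L L) k r).toSubmodule.map
      (derToEnd L))) ?_ fun k => ?_
  · simp only [hn, radBlock, LieSubmodule.bot_toSubmodule, Submodule.map_bot, tensorEnd,
      Submodule.map₂_bot_right, bot_sup_eq]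
    exact solvableBelow_derBlock_jac hz
  · refine commLE_radBlock hz LinearMap.map_le_range ?_
    rintro _ ⟨D, hD, rfl⟩ _ ⟨E, hE, rfl⟩
    refine ⟨⁅D, E⁆, ?_, derToEnd_lie D E⟩
    rw [LieAlgebra.derivedSeriesOfIdeal_succ]
    exact LieSubmodule.lie_mem_lie hD hE

end Radical

/-! ### Evaluation at characters and the semisimplicity of s⊗S. -/

section Semisimple

variable {L A : Type*} [LieRing L] [LieAlgebra ℂ L] [CommRing A] [Algebra ℂ A]

theorem contract_current {Φ : Module.End ℂ (A ⊗[ℂ] L)} {U : Submodule ℂ (Module.End ℂ L)}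
    {V : Submodule ℂ A} (hΦ : Φ ∈ tensorEnd U (mulEnd A V)) (χ : A →ₐ[ℂ] ℂ) (z : A ⊗[ℂ] L) :
    contract χ.toLinearMap (Φ z) = slice Φ 1 χ.toLinearMap (contract χ.toLinearMap z) := by
  rw [tensorEnd_eq_span] at hΦ
  induction hΦ using Submodule.span_induction with
  | zero => simp
  | add Φ Ψ _ _ hΦ hΨ =>
    simp only [slice_apply, LinearMap.add_apply, map_add] at *
    rw [hΦ, hΨ]
  | smul c Φ _ hΦ =>
    simp only [slice_apply, LinearMap.smul_apply, map_smul] at *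
    rw [hΦ]
  | mem Φ hΦ =>
    obtain ⟨_, ⟨a, -, rfl⟩, T, -, rfl⟩ := hΦ
    induction z with
    | zero => simp
    | add u v hu hv => simp only [map_add, hu, hv]
    | tmul b x => simp [mul_smul, smul_comm (χ b)]

theorem slice_mul_of_current {Φ Ψ : Module.End ℂ (A ⊗[ℂ] L)} {U : Submodule ℂ (Module.End ℂ L)}
    {V : Submodule ℂ A} (hΦ : Φ ∈ tensorEnd U (mulEnd A V)) (χ : A →ₐ[ℂ] ℂ) :
    slice (Φ * Ψ) 1 χ.toLinearMap = slice Φ 1 χ.toLinearMap * slice Ψ 1 χ.toLinearMap := by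
  ext x
  exact contract_current hΦ χ (Ψ (1 ⊗ₜ x))

theorem slice_mem_of_current {Φ : Module.End ℂ (A ⊗[ℂ] L)} {U : Submodule ℂ (Module.End ℂ L)}
    {V : Submodule ℂ (Module.End ℂ A)} (hΦ : Φ ∈ tensorEnd U V) (a : A) (φ : A →ₗ[ℂ] ℂ) :
    slice Φ a φ ∈ U := by
  rw [tensorEnd_eq_span] at hΦ
  induction hΦ using Submodule.span_induction with
  | zero => simp [slice]
  | add Φ Ψ _ _ hΦ hΨ => simpa [slice, LinearMap.comp_add, LinearMap.add_comp] using add_mem hΦ hΨ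
  | smul c Φ _ hΦ => simpa [slice, LinearMap.comp_smul, LinearMap.smul_comp] using U.smul_mem c hΦ
  | mem Φ hΦ =>
    obtain ⟨f, -, T, hT, rfl⟩ := hΦ
    have : slice (TensorProduct.map f T) a φ = φ (f a) • T := by ext x; simp
    rw [this]
    exact U.smul_mem _ hT

/-- Along a basis of `U`, vanishing of all evaluations says that every character kills every
coefficient. Characters detect everything outside the radical, so the coefficients lie in `V` and in
`jac A`. -/
theorem eq_zero_of_slice_algHom [FiniteDimensional ℂ A] [FiniteDimensional ℂ L]
    {Φ : Module.End ℂ (A ⊗[ℂ] L)}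
    {U : Submodule ℂ (Module.End ℂ L)} {V : Submodule ℂ A} (hV : Disjoint V (jac A))
    (hΦ : Φ ∈ tensorEnd U (mulEnd A V))
    (h : ∀ χ : A →ₐ[ℂ] ℂ, slice Φ 1 χ.toLinearMap = 0) : Φ = 0 := by
  let u := Module.finBasis ℂ U
  obtain ⟨f, hf, rfl⟩ := exists_sum_map_of_mem_tensorEnd u hΦ
  choose a ha haf using hf
  have ha0 : ∀ i, a i = 0 := by
    intro i
    refine Submodule.disjoint_def.1 hV _ (ha i) ?_
    by_contra hai
    obtain ⟨χ, hχ⟩ := exists_algHom_ne_zero hai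
    refine hχ (Fintype.linearIndependent_iff.1 u.linearIndependent (fun i => χ (a i)) ?_ i)
    refine Subtype.ext (LinearMap.ext fun x => ?_)
    have := LinearMap.congr_fun (h χ) x
    simpa [← haf] using this
  refine Finset.sum_eq_zero fun i _ => ?_
  rw [← haf, ha0, map_zero, TensorProduct.map_zero_left]

/-- The current Lie algebra `s ⊗ S` of a subalgebra `s` of `Der(L)`, inside `Der(L ⊗ A)`. -/
def currentSubalgebra (s : LieSubalgebra ℂ (LieDerivation ℂ L L)) (S : Subalgebra ℂ A) :
    LieSubalgebra ℂ (LieDerivation ℂ (A ⊗[ℂ] L) (A ⊗[ℂ] L)) where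
  toSubmodule := (tensorEnd (s.toSubmodule.map (derToEnd L))
    (mulEnd A (Subalgebra.toSubmodule S))).comap (derToEnd (A ⊗[ℂ] L))
  lie_mem' := by
    intro D E hD hE
    change derToEnd _ ⁅D, E⁆ ∈ tensorEnd (s.toSubmodule.map (derToEnd L))
      (mulEnd A (Subalgebra.toSubmodule S))
    rw [derToEnd_lie]
    refine commLE_current_current (U'' := s.toSubmodule.map (derToEnd L)) ?_
      (fun a ha b hb => S.mul_mem ha hb) _ hD _ hE
    rintro _ ⟨d, hd, rfl⟩ _ ⟨e, he, rfl⟩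
    exact ⟨⁅d, e⁆, s.lie_mem hd he, derToEnd_lie d e⟩

theorem map_currentSubalgebra (s : LieSubalgebra ℂ (LieDerivation ℂ L L)) (S : Subalgebra ℂ A) :
    (currentSubalgebra s S).toSubmodule.map (derToEnd (A ⊗[ℂ] L)) =
      tensorEnd (s.toSubmodule.map (derToEnd L)) (mulEnd A (Subalgebra.toSubmodule S)) :=
  Submodule.map_comap_eq_of_le ((tensorEnd_mono LinearMap.map_le_range (mulEnd_mono le_top)).trans
    current_le_lieDer)

theorem slice_lie {s : LieSubalgebra ℂ (LieDerivation ℂ L L)} {S : Subalgebra ℂ A}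
    {D E : LieDerivation ℂ (A ⊗[ℂ] L) (A ⊗[ℂ] L)} (hD : D ∈ currentSubalgebra s S)
    (hE : E ∈ currentSubalgebra s S) (χ : A →ₐ[ℂ] ℂ) {d e : LieDerivation ℂ L L}
    (hd : slice (derToEnd _ D) 1 χ.toLinearMap = derToEnd L d)
    (he : slice (derToEnd _ E) 1 χ.toLinearMap = derToEnd L e) :
    slice (derToEnd _ ⁅D, E⁆) 1 χ.toLinearMap = derToEnd L ⁅d, e⁆ := by
  rw [derToEnd_lie, derToEnd_lie, ← hd, ← he, ← slice_mul_of_current hD, ← slice_mul_of_current hE]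
  ext x
  simp

/-- The image in `s` of an ideal of `s ⊗ S` under the evaluation at a character of `A`. -/
def evalIdeal {s : LieSubalgebra ℂ (LieDerivation ℂ L L)} {S : Subalgebra ℂ A}
    (I : LieIdeal ℂ (currentSubalgebra s S)) (χ : A →ₐ[ℂ] ℂ) : LieIdeal ℂ s where
  carrier := {d | ∃ D ∈ I, slice (derToEnd _ D.1) 1 χ.toLinearMap = derToEnd L d.1}
  zero_mem' := ⟨0, zero_mem _, by ext; simp⟩
  add_mem' := by
    rintro d e ⟨D, hD, hd⟩ ⟨E, hE, he⟩
    refine ⟨D + E, add_mem hD hE, ?_⟩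
    change slice (derToEnd _ (D.1 + E.1)) 1 χ.toLinearMap = derToEnd L (d.1 + e.1)
    rw [map_add, map_add, ← hd, ← he]
    ext x
    simp
  smul_mem' := by
    rintro c d ⟨D, hD, hd⟩
    refine ⟨c • D, I.smul_mem c hD, ?_⟩
    change slice (derToEnd _ (c • D.1)) 1 χ.toLinearMap = derToEnd L (c • d.1)
    rw [map_smul, map_smul, ← hd]
    ext x
    simp
  lie_mem := by
    rintro e d ⟨D, hD, hd⟩
    -- Evaluation is onto `s`: the element `e` lifts to e⊗1, available because `S` contains 1. Hence
    -- the image of an ideal is an ideal.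
    have h1 : TensorProduct.map (LinearMap.mul ℂ A 1) (derToEnd L e.1) ∈
        tensorEnd (s.toSubmodule.map (derToEnd L)) (mulEnd A (Subalgebra.toSubmodule S)) :=
      map_mem_tensorEnd (Submodule.mem_map_of_mem e.2) (mul_mem_mulEnd S.one_mem)
    obtain ⟨E, hE, hE'⟩ := (map_currentSubalgebra s S).ge h1
    refine ⟨⁅(⟨E, hE⟩ : currentSubalgebra s S), D⁆, lie_mem_right _ _ _ _ _ hD, ?_⟩
    refine slice_lie hE D.2 χ ?_ hd
    rw [hE']
    ext x
    simp

theorem hasTrivialRadical_currentSubalgebra [FiniteDimensional ℂ A] [FiniteDimensional ℂ L]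
    (s : LieSubalgebra ℂ (LieDerivation ℂ L L)) [LieAlgebra.HasTrivialRadical ℂ s]
    (S : Subalgebra ℂ A) (hS : Disjoint (Subalgebra.toSubmodule S) (jac A)) :
    LieAlgebra.HasTrivialRadical ℂ (currentSubalgebra s S) := by
  rw [LieAlgebra.hasTrivialRadical_iff_no_abelian_ideals]
  intro I hI
  rw [LieSubmodule.eq_bot_iff]
  intro D hD
  refine Subtype.ext (derToEnd_injective ?_)
  refine (eq_zero_of_slice_algHom hS D.2 fun χ => ?_).trans (map_zero _).symm
  obtain ⟨d, hd, hd'⟩ := slice_mem_of_current D.2 1 χ.toLinearMap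
  have hK : IsLieAbelian (evalIdeal I χ) := by
    constructor
    rintro ⟨d, D, hD, hd⟩ ⟨e, E, hE, he⟩
    have h0 : ⁅D, E⁆ = 0 := congrArg Subtype.val (hI.trivial ⟨D, hD⟩ ⟨E, hE⟩)
    have h1 := slice_lie D.2 E.2 χ hd he
    rw [← LieSubalgebra.coe_bracket, h0] at h1
    refine Subtype.ext (Subtype.ext (derToEnd_injective ?_))
    refine h1.symm.trans ?_
    ext x
    simp
  have hbot := (LieAlgebra.hasTrivialRadical_iff_no_abelian_ideals ℂ s).1 inferInstance _ hK
  have hmem : (⟨d, hd⟩ : s) ∈ evalIdeal I χ := ⟨D, hD, hd'.symm⟩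
  rw [hbot, LieSubmodule.mem_bot] at hmem
  rw [← hd', show d = 0 from congrArg Subtype.val hmem, map_zero]

end Semisimple

/-- A solvable ideal that together with a subalgebra without radical spans the Lie algebra is the
radical. -/
theorem radical_eq_of_sup_eq_top {M : Type*} [LieRing M] [LieAlgebra ℂ M] [FiniteDimensional ℂ M]
    (W : LieIdeal ℂ M) [LieAlgebra.IsSolvable W] (T : LieSubalgebra ℂ M)
    [LieAlgebra.HasTrivialRadical ℂ T] (h : W.toSubmodule ⊔ T.toSubmodule = ⊤) :
    LieAlgebra.radical ℂ M = W := by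
  have hW : W ≤ LieAlgebra.radical ℂ M := (LieAlgebra.LieIdeal.solvable_iff_le_radical ℂ M W).1 ‹_›
  refine le_antisymm (fun x hx => ?_) hW
  obtain ⟨w, hw, t, ht, rfl⟩ := Submodule.mem_sup.1 (h.ge (Submodule.mem_top (x := x)))
  have ht' : t ∈ LieAlgebra.radical ℂ M := by
    have := sub_mem hx (hW hw)
    rwa [add_sub_cancel_left] at this
  -- The radical cut down to `T` is an ideal of `T`, solvable because it embeds in the radical,
  -- hence zero.
  let K : LieIdeal ℂ T := (LieAlgebra.radical ℂ M).comap T.incl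
  let f : K →ₗ⁅ℂ⁆ LieAlgebra.radical ℂ M :=
    { toFun := fun k => ⟨k.1.1, k.2⟩
      map_add' := fun _ _ => rfl
      map_smul' := fun _ _ => rfl
      map_lie' := rfl }
  have hf : Function.Injective f := fun a b hab =>
    Subtype.ext (Subtype.ext (congrArg (fun z : LieAlgebra.radical ℂ M => (z : M)) hab))
  have hK : LieAlgebra.IsSolvable K := hf.lieAlgebra_isSolvable
  have hbot : K = ⊥ := LieAlgebra.HasTrivialRadical.eq_bot_of_isSolvable K
  have hmem : (⟨t, ht⟩ : T) ∈ K := ht'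
  rw [hbot, LieSubmodule.mem_bot] at hmem
  rw [show t = 0 from congrArg Subtype.val hmem, add_zero]
  exact hw

end CurrentLie

theorem mainTheorem1
    (A : Type*) [CommRing A] [Algebra ℂ A] [FiniteDimensional ℂ A]
    (S : Subalgebra ℂ A) (_hS : IsSemisimpleRing S)
    (_hSJ : IsCompl (Subalgebra.toSubmodule S) (CurrentLie.jac A))
    (g : Type*) [LieRing g] [LieAlgebra ℂ g] [FiniteDimensional ℂ g]
    (_hz : LieAlgebra.center ℂ g ≤ CurrentLie.derived g)
    (s : LieSubalgebra ℂ (LieDerivation ℂ g g)) (_hs : LieAlgebra.IsSemisimple ℂ s)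
    (r : LieIdeal ℂ (LieDerivation ℂ g g))
    (_hr : r = LieAlgebra.radical ℂ (LieDerivation ℂ g g))
    (_hsr : IsCompl s.toSubmodule r.toSubmodule)
    (_hA : LieAlgebra.IsSolvable (Derivation ℂ A A)) :
    (LieAlgebra.radical ℂ (LieDerivation ℂ (A ⊗[ℂ] g) (A ⊗[ℂ] g))).toSubmodule.map
        (CurrentLie.derToEnd (A ⊗[ℂ] g)) =
      CurrentLie.tensorEnd (s.toSubmodule.map (CurrentLie.derToEnd g))
          (CurrentLie.mulEnd A (CurrentLie.jac A)) ⊔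
        CurrentLie.tensorEnd (r.toSubmodule.map (CurrentLie.derToEnd g))
          (CurrentLie.mulEnd A ⊤) ⊔
        CurrentLie.tensorEnd (CurrentLie.centroid g) (CurrentLie.algDer A) ⊔
        CurrentLie.tensorEnd (CurrentLie.homAbCenter g) (⊤ : Submodule ℂ (Module.End ℂ A)) ∧
    ∃ T : LieSubalgebra ℂ (LieDerivation ℂ (A ⊗[ℂ] g) (A ⊗[ℂ] g)),
      T.toSubmodule.map (CurrentLie.derToEnd (A ⊗[ℂ] g)) =
        CurrentLie.tensorEnd (s.toSubmodule.map (CurrentLie.derToEnd g))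
          (CurrentLie.mulEnd A (Subalgebra.toSubmodule S)) ∧
      LieAlgebra.IsSemisimple ℂ T := by
  open CurrentLie in
  have : IsNoetherian ℂ (LieDerivation ℂ g g) := inferInstance
  have : FiniteDimensional ℂ (LieDerivation ℂ (A ⊗[ℂ] g) (A ⊗[ℂ] g)) :=
    Module.IsNoetherian.finite ℂ _
  have : LieAlgebra.IsSolvable r := by rw [_hr]; infer_instance
  have hT := hasTrivialRadical_currentSubalgebra s S _hSJ.disjoint
  have hsr : lieDer g = s.toSubmodule.map (derToEnd g) ⊔ r.toSubmodule.map (derToEnd g) := by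
    rw [← Submodule.map_sup, _hsr.sup_eq_top, lieDer, LinearMap.range_eq_map]
  have hr : CommLE (lieDer g) (r.toSubmodule.map (derToEnd g)) (r.toSubmodule.map (derToEnd g)) := by
    rintro _ ⟨D, rfl⟩ _ ⟨E, hE, rfl⟩
    exact ⟨⁅D, E⁆, lie_mem_right _ _ _ _ _ hE, derToEnd_lie D E⟩
  have hrle : r.toSubmodule.map (derToEnd g) ≤ lieDer g := LinearMap.map_le_range
  have hWle : radBlock A (r.toSubmodule.map (derToEnd g)) ≤ lieDer (A ⊗[ℂ] g) :=
    (sup_le ((tensorEnd_mono hrle le_rfl).trans (current_le_derBlock _ _))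
      (derBlock_mono le_top le_rfl)).trans derBlock_top_le_lieDer
  let W : LieIdeal ℂ (LieDerivation ℂ (A ⊗[ℂ] g) (A ⊗[ℂ] g)) :=
    { (radBlock A (r.toSubmodule.map (derToEnd g))).comap (derToEnd (A ⊗[ℂ] g)) with
      lie_mem := by
        intro D E hE
        change derToEnd _ ⁅D, E⁆ ∈ radBlock A (r.toSubmodule.map (derToEnd g))
        rw [derToEnd_lie]
        exact commLE_derBlock_radBlock (A := A) _hz hrle hr _ (lieDer_current ⟨D, rfl⟩) _ hE }
  have hWmap : W.toSubmodule.map (derToEnd (A ⊗[ℂ] g)) =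
      radBlock A (r.toSubmodule.map (derToEnd g)) := Submodule.map_comap_eq_of_le hWle
  have hWsol : LieAlgebra.IsSolvable W := by
    obtain ⟨k, hk⟩ := solvableBelow_radBlock _hz r W hWmap.le
    exact (LieAlgebra.isSolvable_iff ℂ W).2 ⟨k, (LieIdeal.derivedSeries_eq_bot_iff _ _).2 hk⟩
  have hsJ : radBlock A (r.toSubmodule.map (derToEnd g)) =
      tensorEnd (s.toSubmodule.map (derToEnd g)) (mulEnd A (jac A)) ⊔
        tensorEnd (r.toSubmodule.map (derToEnd g)) (mulEnd A ⊤) ⊔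
        tensorEnd (centroid g) (algDer A) ⊔ tensorEnd (homAbCenter g) ⊤ := by
    have h1 : tensorEnd (r.toSubmodule.map (derToEnd g)) (mulEnd A (jac A)) ≤
        tensorEnd (r.toSubmodule.map (derToEnd g)) (mulEnd A ⊤) :=
      tensorEnd_mono le_rfl (mulEnd_mono le_top)
    have h2 : tensorEnd (lieDer g) (mulEnd A (jac A)) =
        tensorEnd (s.toSubmodule.map (derToEnd g)) (mulEnd A (jac A)) ⊔
          tensorEnd (r.toSubmodule.map (derToEnd g)) (mulEnd A (jac A)) := by
      rw [hsr, tensorEnd, Submodule.map₂_sup_right]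
      rfl
    rw [radBlock, derBlock, h2, ← sup_assoc, ← sup_assoc, sup_left_comm, sup_eq_left.2 h1]
  have htop : W.toSubmodule ⊔ (currentSubalgebra s S).toSubmodule = ⊤ := by
    apply Submodule.map_injective_of_injective (derToEnd_injective (L := A ⊗[ℂ] g))
    rw [Submodule.map_sup, hWmap, map_currentSubalgebra, Submodule.map_top]
    refine le_antisymm (sup_le hWle ?_) (lieDer_current.trans ?_)
    · rw [← map_currentSubalgebra]
      exact LinearMap.map_le_range
    -- Der(g)⊗A = s⊗S + s⊗J + r⊗A, where the last two summands lie in the candidate radical.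
    · have h1 : tensorEnd (lieDer g) (mulEnd A ⊤) ≤
          radBlock A (r.toSubmodule.map (derToEnd g)) ⊔
            tensorEnd (s.toSubmodule.map (derToEnd g)) (mulEnd A (Subalgebra.toSubmodule S)) := by
        have h2 : tensorEnd (s.toSubmodule.map (derToEnd g)) (mulEnd A ⊤) =
            tensorEnd (s.toSubmodule.map (derToEnd g)) (mulEnd A (Subalgebra.toSubmodule S)) ⊔
              tensorEnd (s.toSubmodule.map (derToEnd g)) (mulEnd A (jac A)) := by
          rw [← _hSJ.sup_eq_top, mulEnd, Submodule.map_sup, tensorEnd, Submodule.map₂_sup_left]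
          rfl
        rw [hsr, tensorEnd, Submodule.map₂_sup_right, ← tensorEnd, ← tensorEnd, h2]
        refine sup_le (sup_le le_sup_right ?_) (le_sup_left.trans le_sup_left)
        exact ((tensorEnd_mono LinearMap.map_le_range le_rfl).trans
          (current_le_derBlock _ (algDer A))).trans (le_sup_right.trans le_sup_left)
      refine sup_le (sup_le h1 ?_) ?_
      · exact (centroid_le_derBlock _ _).trans (le_sup_right.trans le_sup_left)
      · exact (homAbCenter_le_derBlock _ _).trans (le_sup_right.trans le_sup_left)
  -- A finite-dimensional complex Lie algebra with trivial radical, here provided by `hT`, is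
  -- semisimple.
  refine ⟨?_, currentSubalgebra s S, map_currentSubalgebra s S, inferInstance⟩
  rw [radical_eq_of_sup_eq_top W (currentSubalgebra s S) htop, hWmap, hsJ]
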